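/- Let $n,k,l$ be positive integers with $l\le k\le n-1$. The stopping rule $\mathcal R_n(k,l)$ selects a term of a permutation $a_1,\dots,a_n$ of $\{1,\dots,n\}$ as follows: let $t$ be the $l$-th lowest value among $a_1,\dots,a_k$; select the first of the terms $a_{k+1},\dots,a_n$ that is less than $t$ if there is one, and $a_n$ otherwise. For a positive integer $d$, the reward for selecting the value $s$ is $n+1-s$ if $s\le d$ and $0$ otherwise, and $V_{n,d}(k,l)$ denotes the expected reward of $\mathcal R_n(k,l)$ when all $n!$ permutations are equally likely. Let $$c_d=\lim_{n\to\infty}\frac{\max\{V_{n,d}(k,l)\mid 1\le l\le k\le n-1\}}{n}.$$ (1) The limit $c_1$ exists and $c_1=1/\mathrm e\approx 0.36788$. Moreover, $V_{n,1}(k,l)\le V_{n,1}(k,1)$ for all $1\le l\le k\le n-1$. (2) The equation $2x-2\log x=3$ has exactly two positive real roots; let $x$ be the smaller one. Then $x\approx 0.30171$, the limit $c_2$ exists, and $c_2=2x-x^2\approx 0.51239$. Moreover, for fixed $n$ and $k$, $V_{n,2}(k,l)$ is non-increasing in $l$ for $2\le l\le k$; as $n\to\infty$, $$\frac{\max_{1\le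 k\le n-1}V_{n,2}(k,1)}{n}\to 2x-x^2,\qquad \frac{\max_{2\le k\le n-1}V_{n,2}(k,2)}{n}\to\frac12;$$ and $\max_k V_{n,2}(k,2)<\max_k V_{n,2}(k,1)$ for all sufficiently large $n$. Here each $\approx$ means that the error is less than $5\cdot 10^{-6}$. -/

import Mathlib

open Filter Topology

noncomputable section

namespace Secretary

/-- A permutation of `Fin n` is read as a sequence `a_1, …, a_n` with the values `1, …, n`:
`rank σ i` is `a_i`, the absolute rank (1 is best) of the applicant interviewed `i`-th.
The value outside `1 ≤ i ≤ n` is irrelevant. -/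
def rank {n : ℕ} (σ : Equiv.Perm (Fin n)) (i : ℕ) : ℕ :=
  if h : 1 ≤ i ∧ i ≤ n then (σ ⟨i - 1, by omega⟩ : ℕ) + 1 else 0

/-- The test value: the `l`-th lowest value among `a_1, …, a_k` (for `1 ≤ l ≤ k ≤ n`).
`Nat.nth` counts from `0`. -/
def testValue {n : ℕ} (σ : Equiv.Perm (Fin n)) (k l : ℕ) : ℕ :=
  Nat.nth (fun m => ∃ i, 1 ≤ i ∧ i ≤ k ∧ rank σ i = m) (l - 1)

/-- The set of all `i` with `1 ≤ i ≤ n - k` for which `a_{k+i}` is below the test value. -/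
def successSet {n : ℕ} (σ : Equiv.Perm (Fin n)) (k l : ℕ) : Finset ℕ :=
  (Finset.Icc 1 (n - k)).filter fun i => rank σ (k + i) < testValue σ k l

/-- The value selected by the stopping rule with parameters `k` and `l`: the first of
`a_{k+1}, …, a_n` that is below the test value, or `a_n` if there is none. -/
def selected {n : ℕ} (σ : Equiv.Perm (Fin n)) (k l : ℕ) : ℕ :=
  if h : (successSet σ k l).Nonempty then rank σ (k + (successSet σ k l).min' h)
  else rank σ (k + (n - k))

/-- The reward for hiring the applicant of absolute rank `s`. -/
def reward (n d s : ℕ) : ℝ :=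
  if s ≤ d then (n : ℝ) + 1 - s else 0

/-- `V_{n,d}(k,l)`: the expected reward when all `n!` orders are equally likely. -/
def expectedReward (n d k l : ℕ) : ℝ :=
  (∑ σ : Equiv.Perm (Fin n), reward n d (selected σ k l)) / (n.factorial : ℝ)

/-- The values `V_{n,d}(k,l)` for all admissible `k`, `l`, that is, `1 ≤ l ≤ k ≤ n - 1`. -/
def rewardSet (n d : ℕ) : Set ℝ :=
  {v | ∃ k l : ℕ, 1 ≤ l ∧ l ≤ k ∧ k < n ∧ v = expectedReward n d k l}

/-- The values `V_{n,d}(k,l)` for a fixed `l` and all admissible `k`. -/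
def rewardSetAt (n d l : ℕ) : Set ℝ :=
  {v | ∃ k : ℕ, 1 ≤ l ∧ l ≤ k ∧ k < n ∧ v = expectedReward n d k l}

/-- `max {V_{n,d}(k,l) | k, l}`; a true maximum as soon as `n ≥ 2`, see `maxReward_isGreatest`. -/
def maxReward (n d : ℕ) : ℝ := sSup (rewardSet n d)

/-- `max {V_{n,d}(k,l) | k}` for a fixed `l`; see `maxRewardAt_isGreatest`. -/
def maxRewardAt (n d l : ℕ) : ℝ := sSup (rewardSetAt n d l)

theorem rewardSet_finite (n d : ℕ) : (rewardSet n d).Finite := by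
  refine (((Set.finite_Iio n).prod (Set.finite_Iio n)).image
    fun p : ℕ × ℕ => expectedReward n d p.1 p.2).subset ?_
  rintro v ⟨k, l, _, hlk, hkn, rfl⟩
  exact ⟨(k, l), ⟨hkn, lt_of_le_of_lt hlk hkn⟩, rfl⟩

theorem maxReward_isGreatest {n : ℕ} (hn : 2 ≤ n) (d : ℕ) :
    IsGreatest (rewardSet n d) (maxReward n d) :=
  ⟨Set.Nonempty.csSup_mem ⟨_, 1, 1, le_rfl, le_rfl, hn, rfl⟩ (rewardSet_finite n d),
    fun _ hv => le_csSup (rewardSet_finite n d).bddAbove hv⟩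

theorem maxRewardAt_isGreatest {n l : ℕ} (hl : 1 ≤ l) (hn : l < n) (d : ℕ) :
    IsGreatest (rewardSetAt n d l) (maxRewardAt n d l) := by
  have hsub : rewardSetAt n d l ⊆ rewardSet n d := by
    rintro v ⟨k, h1, h2, h3, rfl⟩
    exact ⟨k, l, h1, h2, h3, rfl⟩
  have hfin := (rewardSet_finite n d).subset hsub
  exact ⟨Set.Nonempty.csSup_mem ⟨_, l, hl, le_rfl, hn, rfl⟩ hfin,
    fun _ hv => le_csSup hfin.bddAbove hv⟩

end Secretary

end

/-!
A term among the `d` lowest values has fewer than `d` lower terms before it, so once `d ≤ l` it is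
below the test value wherever it occurs. Lowering the test value from parameter `l'` to `l` then
never loses a rewarded selection, which makes `V_{n,d}(k,l)` non-increasing in `l ≥ d`.

For a value `v < l`, counted from `0`, at a position `m ≥ k`, the rule selects it if and only if
none of the terms at positions `k, …, m - 1` is below the test value, that is, if and only if the
`l` lowest of the first `m` terms all lie among the first `k`. The set of their positions is
uniformly distributed and independent of the later terms, so this has probability
`k.choose l / m.choose l`. Summing over `m` gives the probabilities of the values `1` (for `l = 1`)
and `1`, `2` (for `l = 2`). For `l = 1` the value `2` is handled by swapping it with the value `1`:
this is harmless unless one of the two is among the first `k` terms, and that case is counted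
directly.

The resulting closed forms are governed by `k * ∑ m ∈ Ico k n, 1 / m`. After division by `n` they
are within `O(1 / n)`, uniformly in `k`, of functions of `t = k / n`, namely `-t log t`,
`-2 t log t - t (1 - t)` and `2 t (1 - t)`, so the maxima converge to the maxima of these functions
over `(0, 1)`. The derivative of the second one is `2 t - 2 log t - 3`, whence the equation for `x`.
-/

namespace Secretary

open Finset Equiv

section Selection

variable {n : ℕ} {σ : Perm (Fin n)} {k l : ℕ}

/-- The number of terms among the first `M` that are lower than the term at position `j`.
Positions and values are counted from `0` here, as elements of `Fin n`. -/
def lowerCount (σ : Perm (Fin n)) (M : ℕ) (j : Fin n) : ℕ :=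
  #{i : Fin n | (i : ℕ) < M ∧ σ i < σ j}

/-- The stopping rule with parameters `k` and `l` stops at position `j`: the position is past the
first `k`, no earlier such position holds a term below the test value, and `j` holds one or is the
last position. The comparison with the test value is expressed by `lowerCount`. -/
def StopsAt (σ : Perm (Fin n)) (k l : ℕ) (j : Fin n) : Prop :=
  k ≤ (j : ℕ) ∧ (∀ i : Fin n, k ≤ (i : ℕ) → i < j → l ≤ lowerCount σ k i) ∧
    (lowerCount σ k j < l ∨ (j : ℕ) = n - 1)

theorem rank_val_add_one (σ : Perm (Fin n)) (i : Fin n) : rank σ (i + 1) = σ i + 1 := by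
  rw [rank, dif_pos ⟨by omega, i.isLt⟩]
  rfl

theorem exists_rank_eq_iff (hk : k ≤ n) {m : ℕ} :
    (∃ i, 1 ≤ i ∧ i ≤ k ∧ rank σ i = m) ↔ ∃ i : Fin n, (i : ℕ) < k ∧ (σ i : ℕ) + 1 = m := by
  constructor
  · rintro ⟨i, h1, hik, rfl⟩
    obtain ⟨i, rfl⟩ := Nat.exists_eq_add_of_le' h1
    exact ⟨⟨i, by omega⟩, hik, (rank_val_add_one σ ⟨i, by omega⟩).symm⟩
  · rintro ⟨i, hik, rfl⟩
    exact ⟨i + 1, by omega, hik, rank_val_add_one σ i⟩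

theorem count_exists_rank_eq [DecidablePred fun m => ∃ i, 1 ≤ i ∧ i ≤ k ∧ rank σ i = m]
    (hk : k ≤ n) (a : ℕ) :
    Nat.count (fun m => ∃ i, 1 ≤ i ∧ i ≤ k ∧ rank σ i = m) a =
      #{i : Fin n | (i : ℕ) < k ∧ (σ i : ℕ) + 1 < a} := by
  have hinj : Function.Injective fun i : Fin n => (σ i : ℕ) + 1 :=
    (add_left_injective 1).comp (Fin.val_injective.comp σ.injective)
  rw [Nat.count_eq_card_filter_range, ← card_image_of_injective _ hinj]
  congr 1
  ext m
  simp only [mem_filter, mem_range, exists_rank_eq_iff hk, mem_image, mem_univ, true_and]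
  grind

theorem le_nth_iff_count_le {p : ℕ → Prop} [DecidablePred p] {a m : ℕ}
    (hm : ∀ hp : (Set.ofPred p).Finite, m < #hp.toFinset) :
    a ≤ Nat.nth p m ↔ Nat.count p a ≤ m := by
  refine ⟨Nat.le_nth_of_count_le, fun h => ?_⟩
  by_contra! hlt
  have := Nat.count_monotone p (Nat.succ_le_of_lt hlt)
  rw [Nat.succ_eq_add_one, Nat.count_nth_succ hm] at this
  omega

theorem card_filter_val_lt {M : ℕ} (hM : M ≤ n) : #{i : Fin n | (i : ℕ) < M} = M := by
  rw [Fin.card_filter_val_lt, min_eq_right hM]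

theorem rank_lt_testValue_iff (hl : 1 ≤ l) (hlk : l ≤ k) {j : Fin n} (hkj : k ≤ (j : ℕ)) :
    rank σ (j + 1) < testValue σ k l ↔ lowerCount σ k j < l := by
  classical
  have hkn : k ≤ n := hkj.trans j.isLt.le
  have hcard : Nat.count (fun m => ∃ i, 1 ≤ i ∧ i ≤ k ∧ rank σ i = m) (n + 1) = k := by
    simp only [count_exists_rank_eq hkn, add_lt_add_iff_right, Fin.is_lt, and_true]
    exact card_filter_val_lt hkn
  have hcount :
      Nat.count (fun m => ∃ i, 1 ≤ i ∧ i ≤ k ∧ rank σ i = m) (rank σ (j + 1) + 1) =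
        lowerCount σ k j := by
    rw [count_exists_rank_eq hkn, lowerCount, rank_val_add_one]
    congr 1
    refine filter_congr fun i _ => and_congr_right fun hik => ?_
    have hne : (σ i : ℕ) ≠ σ j := fun h => by
      have := σ.injective (Fin.val_injective h)
      omega
    omega
  rw [testValue, ← Nat.succ_le_iff, Nat.succ_eq_add_one, le_nth_iff_count_le, hcount]
  · omega
  · intro hp
    have := Nat.count_le_card hp (n + 1)
    omega

theorem lowerCount_le_val (σ : Perm (Fin n)) (M : ℕ) (j : Fin n) : lowerCount σ M j ≤ σ j := by
  rw [← Fin.card_Iio]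
  exact card_le_card_of_injOn σ (fun i hi => by simp_all) σ.injective.injOn

theorem StopsAt.unique {i j : Fin n} (hi : StopsAt σ k l i) (hj : StopsAt σ k l j) : i = j := by
  have not_lt_of_stopsAt {i j : Fin n} (hi : StopsAt σ k l i) (hj : StopsAt σ k l j) :
      ¬ i < j := fun hij => by
    have := hj.2.1 i hi.1 hij
    have := hi.2.2
    omega
  exact le_antisymm (not_lt.1 (not_lt_of_stopsAt hj hi)) (not_lt.1 (not_lt_of_stopsAt hi hj))

theorem mem_successSet_iff (hl : 1 ≤ l) (hlk : l ≤ k) {j : Fin n} (hkj : k ≤ (j : ℕ)) :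
    (j : ℕ) + 1 - k ∈ successSet σ k l ↔ lowerCount σ k j < l := by
  rw [← rank_lt_testValue_iff hl hlk hkj, successSet, mem_filter, mem_Icc,
    show k + ((j : ℕ) + 1 - k) = j + 1 by omega]
  exact and_iff_right (by omega)

theorem exists_stopsAt (hl : 1 ≤ l) (hlk : l ≤ k) (hkn : k < n) (σ : Perm (Fin n)) :
    ∃ j, StopsAt σ k l j ∧ selected σ k l = σ j + 1 := by
  by_cases h : (successSet σ k l).Nonempty
  · set i := (successSet σ k l).min' h with hi
    have hmem : i ∈ successSet σ k l := min'_mem _ h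
    obtain ⟨hi1, hin⟩ := mem_Icc.1 (mem_filter.1 hmem).1
    obtain ⟨j, hj⟩ : ∃ j : Fin n, k + i = j + 1 := ⟨⟨k + i - 1, by omega⟩, by simp; omega⟩
    refine ⟨j, ⟨by omega, fun a hka haj => ?_, Or.inl ?_⟩, ?_⟩
    · by_contra! hlt
      have := min'_le _ _ ((mem_successSet_iff hl hlk hka).2 hlt)
      omega
    · rwa [← mem_successSet_iff hl hlk (by omega), show (j : ℕ) + 1 - k = i by omega]
    · rw [selected, dif_pos h, ← hi, hj, rank_val_add_one]
  · refine ⟨⟨n - 1, by omega⟩, ⟨by simp; omega, fun a hka _ => ?_, Or.inr rfl⟩, ?_⟩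
    · by_contra! hlt
      exact h ⟨_, (mem_successSet_iff hl hlk hka).2 hlt⟩
    · rw [selected, dif_neg h, ← rank_val_add_one]
      congr 1
      simp
      omega

theorem selected_eq_iff (hl : 1 ≤ l) (hlk : l ≤ k) (hkn : k < n) (σ : Perm (Fin n)) (v : Fin n) :
    selected σ k l = v + 1 ↔ StopsAt σ k l (σ.symm v) := by
  obtain ⟨j, hj, hsel⟩ := exists_stopsAt hl hlk hkn σ
  rw [hsel]
  constructor
  · intro h
    rwa [← show σ j = v from Fin.ext (by omega), symm_apply_apply]
  · intro h
    rw [hj.unique h, apply_symm_apply]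

theorem one_le_selected (hl : 1 ≤ l) (hlk : l ≤ k) (hkn : k < n) (σ : Perm (Fin n)) :
    1 ≤ selected σ k l := by
  obtain ⟨j, -, hsel⟩ := exists_stopsAt hl hlk hkn σ
  omega

theorem selected_eq_of_le {d l' : ℕ} (hl : 1 ≤ l) (hdl : d ≤ l) (hll' : l ≤ l') (hl'k : l' ≤ k)
    (hkn : k < n) (hd : selected σ k l' ≤ d) : selected σ k l = selected σ k l' := by
  obtain ⟨j, ⟨hkj, hbefore, -⟩, hsel⟩ := exists_stopsAt (hl.trans hll') hl'k hkn σ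
  rw [hsel, selected_eq_iff hl (hll'.trans hl'k) hkn, symm_apply_apply]
  have := lowerCount_le_val σ k j
  exact ⟨hkj, fun i hki hij => hll'.trans (hbefore i hki hij), Or.inl (by omega)⟩

theorem reward_nonneg {d : ℕ} (hd : d ≤ n + 1) (s : ℕ) : 0 ≤ reward n d s := by
  unfold reward
  split_ifs with h
  · have : (s : ℝ) ≤ n + 1 := by exact_mod_cast h.trans hd
    linarith
  · exact le_rfl

theorem expectedReward_le_of_le {d l' : ℕ} (hl : 1 ≤ l) (hdl : d ≤ l) (hll' : l ≤ l')
    (hl'k : l' ≤ k) (hkn : k < n) : expectedReward n d k l' ≤ expectedReward n d k l := by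
  refine div_le_div_of_nonneg_right (sum_le_sum fun σ _ => ?_) (Nat.cast_nonneg _)
  by_cases hd : selected σ k l' ≤ d
  · rw [selected_eq_of_le hl hdl hll' hl'k hkn hd]
  · rw [reward, if_neg hd]
    exact reward_nonneg (by omega) _

end Selection

section Prob

variable {α : Type*} [Fintype α] {p q : α → Prop}

open Classical in
/-- The probability that a uniformly random element of the finite type `α` satisfies `p`. -/
noncomputable def prob (p : α → Prop) : ℝ := (#{a | p a} : ℝ) / Fintype.card α

theorem prob_congr (h : ∀ a, p a ↔ q a) : prob p = prob q :=
  congrArg prob (funext fun a => propext (h a))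

theorem prob_true [Nonempty α] : prob (fun _ : α => True) = 1 := by
  simp [prob, Fintype.card_ne_zero]

theorem prob_comp_equiv (e : α ≃ α) (p : α → Prop) : prob (fun a => p (e a)) = prob p := by
  classical
  rw [prob, prob, card_equiv e (t := {a | p a}) (by simp)]

theorem prob_eq_sum {β : Type*} (f : α → β) {S : Finset β} (h : ∀ a, p a → f a ∈ S) :
    prob p = ∑ x ∈ S, prob fun a => p a ∧ f a = x := by
  classical
  have hmaps : Set.MapsTo f ({a | p a} : Finset α) S := fun a ha => h a (by simpa using ha)
  simp only [prob, card_eq_sum_card_fiberwise hmaps, Nat.cast_sum, sum_div, filter_filter]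

theorem prob_eq_add (p q : α → Prop) :
    prob p = prob (fun a => p a ∧ q a) + prob (fun a => p a ∧ ¬ q a) := by
  classical
  rw [prob_eq_sum q (S := {True, False}) (by grind), sum_pair (by simp)]
  simp only [eq_iff_iff, iff_true, iff_false]

/-- Right multiplications permute the fibres of `f` on `q` transitively, so the fibres are equally
likely. -/
theorem prob_and_mem_eq {G β : Type*} [Group G] [Fintype G] {q : G → Prop} {f : G → β}
    {S U : Finset β} (hf : ∀ σ, q σ → f σ ∈ S) (hUS : U ⊆ S)
    (h : ∀ x ∈ S, ∀ y ∈ S, ∃ π, ∀ σ, q σ → f σ = x → q (σ * π) ∧ f (σ * π) = y) :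
    prob (fun σ => q σ ∧ f σ ∈ U) = #U / #S * prob q := by
  classical
  obtain rfl | ⟨u, hu⟩ := U.eq_empty_or_nonempty
  · simp [prob]
  have prob_fibre_le {x y} (hx : x ∈ S) (hy : y ∈ S) :
      prob (fun σ => q σ ∧ f σ = x) ≤ prob fun σ => q σ ∧ f σ = y := by
    obtain ⟨π, hπ⟩ := h x hx y hy
    refine div_le_div_of_nonneg_right (Nat.cast_le.2 ?_) (Nat.cast_nonneg _)
    exact card_le_card_of_injOn (· * π) (fun σ hσ => by simp_all) (mul_left_injective π).injOn
  have prob_fibre_eq {x} (hx : x ∈ S) :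
      prob (fun σ => q σ ∧ f σ = x) = prob fun σ => q σ ∧ f σ = u :=
    le_antisymm (prob_fibre_le hx (hUS hu)) (prob_fibre_le (hUS hu) hx)
  have hS : (#S : ℝ) ≠ 0 := by
    exact_mod_cast card_ne_zero_of_mem (hUS hu)
  have hU : prob (fun σ => q σ ∧ f σ ∈ U) = #U * prob fun σ => q σ ∧ f σ = u := by
    rw [prob_eq_sum f fun _ h => h.2, ← nsmul_eq_mul]
    refine sum_eq_card_nsmul fun x hx => ?_
    rw [← prob_fibre_eq (hUS hx)]
    exact prob_congr fun σ => by grind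
  rw [hU, prob_eq_sum f hf, sum_congr rfl fun x hx => prob_fibre_eq hx, sum_const, nsmul_eq_mul]
  field_simp

end Prob

section Uniform

variable {n : ℕ}

theorem expectedReward_eq_sum_prob (d : ℕ) {k l : ℕ} (hl : 1 ≤ l) (hlk : l ≤ k) (hkn : k < n) :
    expectedReward n d k l =
      ∑ v ∈ range d, ((n : ℝ) - v) * prob fun σ : Perm (Fin n) => selected σ k l = v + 1 := by
  have reward_eq (σ : Perm (Fin n)) : reward n d (selected σ k l) =
      ∑ v ∈ range d, if selected σ k l = v + 1 then (n : ℝ) - v else 0 := by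
    obtain ⟨s, hs⟩ := Nat.exists_eq_add_of_le' (one_le_selected hl hlk hkn σ)
    simp only [hs, add_left_inj, sum_ite_eq, mem_range, reward, Nat.succ_le_iff, Nat.cast_add,
      Nat.cast_one, add_sub_add_right_eq_sub]
  simp only [expectedReward, reward_eq]
  rw [sum_comm, sum_div]
  refine sum_congr rfl fun v _ => ?_
  rw [← sum_filter, sum_const, nsmul_eq_mul, prob, Fintype.card_perm, Fintype.card_fin,
    mul_comm, mul_div_assoc]
  congr!

theorem prob_apply_eq (m v : Fin n) : prob (fun σ : Perm (Fin n) => σ m = v) = 1 / n := by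
  have key := prob_and_mem_eq (q := fun _ : Perm (Fin n) => True) (f := fun σ => σ.symm v)
    (fun _ _ => mem_univ _) (subset_univ {m})
    (fun x _ y _ => ⟨swap x y, fun σ _ hx => ⟨trivial, by
      simp [hx, Perm.mul_def]⟩⟩)
  rw [prob_true, mul_one, card_singleton, card_fin, Nat.cast_one] at key
  rw [← key]
  exact prob_congr fun σ => by rw [true_and, mem_singleton, symm_apply_eq, eq_comm]

theorem prob_symm_mem_and_symm_mem {v w : Fin n} (hvw : v ≠ w) {A B : Finset (Fin n)}
    (hAB : Disjoint A B) :
    prob (fun σ : Perm (Fin n) => σ.symm v ∈ A ∧ σ.symm w ∈ B) =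
      #A * #B / (n * (n - 1)) := by
  have hn : 1 ≤ n := Fin.pos v
  have exists_perm (x) (hx : x ∈ (univ : Finset (Fin n)).offDiag) (y)
      (hy : y ∈ (univ : Finset (Fin n)).offDiag) :
      ∃ π : Perm (Fin n), ∀ σ : Perm (Fin n), True → (σ.symm v, σ.symm w) = x →
        True ∧ ((σ * π).symm v, (σ * π).symm w) = y := by
    obtain ⟨π, h₁, h₂⟩ := (MulAction.is_two_pretransitive_iff).1
      (Perm.isMultiplyPretransitive (Fin n) 2) (mem_offDiag.1 hy).2.2 (mem_offDiag.1 hx).2.2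
    refine ⟨π, fun σ _ hσ => ⟨trivial, ?_⟩⟩
    obtain ⟨hv, hw⟩ := Prod.ext_iff.1 hσ
    ext1 <;> simp_all [Perm.mul_def, symm_apply_eq]
  have key := prob_and_mem_eq (q := fun _ : Perm (Fin n) => True)
    (f := fun σ => (σ.symm v, σ.symm w)) (S := univ.offDiag) (U := A ×ˢ B)
    (fun σ _ => by simp [hvw])
    (fun x hx => by
      have := hAB.forall_ne_finset (mem_product.1 hx).1 (mem_product.1 hx).2
      simp [this])
    exists_perm
  rw [prob_true, mul_one, card_product, offDiag_card, card_fin, Nat.cast_sub (by nlinarith)] at key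
  push_cast at key
  rw [mul_sub_one, ← key]
  exact prob_congr fun σ => by simp

end Uniform

theorem exists_perm_mem_iff {α : Type*} {A S T : Finset α}
    (hS : S ⊆ A) (hT : T ⊆ A) (h : #S = #T) :
    ∃ π : Perm α, (∀ i ∉ A, π i = i) ∧ ∀ i, π i ∈ S ↔ i ∈ T := by
  classical
  have card_subtype_eq {U : Finset α} (hU : U ⊆ A) : #(U.subtype (· ∈ A)) = #U := by
    rw [card_subtype, filter_true_of_mem hU]
  obtain ⟨τ, hτ⟩ := Perm.exists_map_finset_eq (T.subtype (· ∈ A)) (S.subtype (· ∈ A))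
    (by rw [card_subtype_eq hT, card_subtype_eq hS, h])
  refine ⟨Perm.ofSubtype τ, fun i => Perm.ofSubtype_apply_of_not_mem τ, fun i => ?_⟩
  by_cases hi : i ∈ A
  · rw [Perm.ofSubtype_apply_of_mem τ hi, ← mem_subtype, ← hτ]
    simp
  · rw [Perm.ofSubtype_apply_of_not_mem τ hi]
    exact iff_of_false (fun h => hi (hS h)) fun h => hi (hT h)

section Lowest

variable {n : ℕ} {σ π : Perm (Fin n)} {k l M : ℕ}

/-- The positions of the `l` lowest among the first `M` terms. -/
def lowest (σ : Perm (Fin n)) (M l : ℕ) : Finset (Fin n) :=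
  {i : Fin n | (i : ℕ) < M ∧ lowerCount σ M i < l}

theorem mem_lowest {i : Fin n} : i ∈ lowest σ M l ↔ (i : ℕ) < M ∧ lowerCount σ M i < l := by
  simp [lowest]

theorem lowest_subset : lowest σ M l ⊆ ({i : Fin n | (i : ℕ) < M} : Finset (Fin n)) :=
  monotone_filter_right _ fun _ _ h => h.1

theorem lowerCount_lt_of_lt {i j : Fin n} (hi : (i : ℕ) < M) (h : σ i < σ j) :
    lowerCount σ M i < lowerCount σ M j := by
  refine card_lt_card ((ssubset_iff_of_subset ?_).2 ⟨i, by simp [hi, h], by simp⟩)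
  exact monotone_filter_right _ fun _ _ ha => ⟨ha.1, ha.2.trans h⟩

theorem lt_of_lowerCount_lt {i j : Fin n} (hj : (j : ℕ) < M)
    (h : lowerCount σ M i < lowerCount σ M j) : σ i < σ j := by
  by_contra! hji
  obtain heq | hlt := hji.eq_or_lt
  · rw [σ.injective heq] at h
    exact lt_irrefl _ h
  · exact h.not_gt (lowerCount_lt_of_lt hj hlt)

theorem lowerCount_lt {i : Fin n} (hi : (i : ℕ) < M) (hM : M ≤ n) : lowerCount σ M i < M := by
  conv_rhs => rw [← card_filter_val_lt hM]
  refine card_lt_card ((ssubset_iff_of_subset ?_).2 ⟨i, by simpa using hi, by simp⟩)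
  exact monotone_filter_right _ fun _ _ ha => ha.1

theorem lowerCount_mono (hkM : k ≤ M) (j : Fin n) : lowerCount σ k j ≤ lowerCount σ M j :=
  card_le_card (monotone_filter_right _ fun _ _ ha => ⟨ha.1.trans_le hkM, ha.2⟩)

theorem injOn_lowerCount :
    Set.InjOn (lowerCount σ M) ({i : Fin n | (i : ℕ) < M} : Finset (Fin n)) := by
  intro i hi j hj hij
  by_contra hne
  obtain h | h := (σ.injective.ne hne).lt_or_gt
  · exact (lowerCount_lt_of_lt (by simpa using hi) h).ne hij
  · exact (lowerCount_lt_of_lt (by simpa using hj) h).ne' hij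

theorem card_lowest (σ : Perm (Fin n)) (hlM : l ≤ M) (hM : M ≤ n) : #(lowest σ M l) = l := by
  have hsurj : Set.SurjOn (lowerCount σ M) ({i : Fin n | (i : ℕ) < M} : Finset (Fin n))
      (range M) :=
    surjOn_of_injOn_of_card_le _ (fun i hi => by simpa using lowerCount_lt (by simpa using hi) hM)
      injOn_lowerCount (by rw [card_filter_val_lt hM, card_range])
  refine (card_nbij (t := range l) (lowerCount σ M) (fun i hi => mem_range.2 (mem_lowest.1 hi).2)
    (injOn_lowerCount.mono (coe_subset.2 lowest_subset)) fun m hm => ?_).trans (card_range l)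
  have hml : m < l := by simpa using hm
  obtain ⟨i, hi, rfl⟩ := hsurj (by simpa using hml.trans_le hlM)
  exact ⟨i, mem_lowest.2 ⟨by simpa using hi, hml⟩, rfl⟩

theorem forall_le_lowerCount_iff (hlM : l ≤ M) (hkM : k ≤ M) (hM : M ≤ n) :
    (∀ j : Fin n, k ≤ (j : ℕ) → (j : ℕ) < M → l ≤ lowerCount σ k j) ↔
      lowest σ M l ⊆ ({i : Fin n | (i : ℕ) < k} : Finset (Fin n)) := by
  constructor
  · intro h i hi
    obtain ⟨hiM, hil⟩ := mem_lowest.1 hi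
    by_contra hik
    have := h i (by simpa using hik) hiM
    have := lowerCount_mono (σ := σ) hkM i
    omega
  · intro h j hkj hjM
    have hj : l ≤ lowerCount σ M j := by
      by_contra! hlt
      have : (j : ℕ) < k := by simpa using h (mem_lowest.2 ⟨hjM, hlt⟩)
      omega
    rw [← card_lowest σ hlM hM]
    refine card_le_card fun i hi => ?_
    have hik : (i : ℕ) < k := by simpa using h hi
    simpa [hik] using lt_of_lowerCount_lt hjM ((mem_lowest.1 hi).2.trans_le hj)

theorem val_lt_iff_of_fixes (hπ : ∀ i : Fin n, M ≤ (i : ℕ) → π i = i) (i : Fin n) :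
    (π i : ℕ) < M ↔ (i : ℕ) < M := by
  rw [← not_le, ← not_le, not_iff_not]
  refine ⟨fun h => ?_, fun h => by rwa [hπ i h]⟩
  rwa [π.injective (hπ (π i) h)] at h

theorem mem_lowest_mul (hπ : ∀ i : Fin n, M ≤ (i : ℕ) → π i = i) {i : Fin n} :
    i ∈ lowest (σ * π) M l ↔ π i ∈ lowest σ M l := by
  have hcount : lowerCount (σ * π) M i = lowerCount σ M (π i) := by
    rw [lowerCount, lowerCount]
    refine card_equiv π fun a => ?_
    rw [mem_filter_univ, mem_filter_univ, val_lt_iff_of_fixes hπ, Perm.mul_apply, Perm.mul_apply]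
  rw [mem_lowest, mem_lowest, hcount, val_lt_iff_of_fixes hπ]

theorem prob_and_forall_le_lowerCount (hlk : l ≤ k) (hkM : k ≤ M) (hM : M ≤ n)
    {q : Perm (Fin n) → Prop}
    (hq : ∀ σ π, (∀ i : Fin n, M ≤ (i : ℕ) → π i = i) → q σ → q (σ * π)) :
    prob (fun σ => q σ ∧ ∀ j : Fin n, k ≤ (j : ℕ) → (j : ℕ) < M → l ≤ lowerCount σ k j) =
      k.choose l / M.choose l * prob q := by
  have hlM := hlk.trans hkM
  have key := prob_and_mem_eq (q := q) (f := fun σ => lowest σ M l)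
    (S := powersetCard l {i : Fin n | (i : ℕ) < M}) (U := powersetCard l {i : Fin n | (i : ℕ) < k})
    (fun σ _ => mem_powersetCard.2 ⟨lowest_subset, card_lowest σ hlM hM⟩)
    (powersetCard_mono (monotone_filter_right _ fun _ _ h => h.trans_le hkM))
    (fun S hS T hT => by
      rw [mem_powersetCard] at hS hT
      obtain ⟨π, hfix, hmem⟩ := exists_perm_mem_iff hS.1 hT.1 (hS.2.trans hT.2.symm)
      have hπ (i : Fin n) (hi : M ≤ (i : ℕ)) : π i = i := hfix i (by simpa using hi)
      refine ⟨π, fun σ hσ hσS => ⟨hq σ π hπ hσ, ?_⟩⟩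
      ext i
      rw [mem_lowest_mul hπ, hσS, hmem])
  rw [card_powersetCard, card_powersetCard, card_filter_val_lt hM,
    card_filter_val_lt (hkM.trans hM)] at key
  rw [← key]
  refine prob_congr fun σ => and_congr_right fun _ => ?_
  rw [forall_le_lowerCount_iff hlM hkM hM, mem_powersetCard, card_lowest σ hlM hM]
  exact (and_iff_left rfl).symm

end Lowest

section SelectionProb

variable {n k l : ℕ}

theorem prob_apply_eq_and_forall_le_lowerCount (hlk : l ≤ k) {m : Fin n} (hkm : k ≤ (m : ℕ))
    (v : Fin n) :
    prob (fun σ : Perm (Fin n) =>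
        σ m = v ∧ ∀ j : Fin n, k ≤ (j : ℕ) → (j : ℕ) < m → l ≤ lowerCount σ k j) =
      k.choose l / (m : ℕ).choose l / n := by
  rw [prob_and_forall_le_lowerCount hlk hkm m.isLt.le, prob_apply_eq, mul_one_div]
  exact fun σ π hπ hσ => by rw [Perm.mul_apply, hπ m le_rfl, hσ]

theorem prob_selected_eq_of_lt (hlk : l ≤ k) (hkn : k < n) {v : ℕ} (hv : v < l) :
    prob (fun σ : Perm (Fin n) => selected σ k l = v + 1) =
      (∑ m ∈ Ico k n, (k.choose l : ℝ) / m.choose l) / n := by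
  have hl : 1 ≤ l := by omega
  have hstops (σ : Perm (Fin n)) :
      selected σ k l = v + 1 ↔ StopsAt σ k l (σ.symm ⟨v, by omega⟩) :=
    selected_eq_iff hl hlk hkn σ ⟨v, by omega⟩
  rw [prob_eq_sum (fun σ : Perm (Fin n) => (σ.symm ⟨v, by omega⟩ : ℕ)) (S := Ico k n)
    fun σ hσ => mem_Ico.2 ⟨((hstops σ).1 hσ).1, Fin.isLt _⟩, sum_div]
  refine sum_congr rfl fun m hm => ?_
  obtain ⟨hkm, hmn⟩ := mem_Ico.1 hm
  rw [← prob_apply_eq_and_forall_le_lowerCount hlk (m := ⟨m, hmn⟩) hkm ⟨v, by omega⟩]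
  refine prob_congr fun σ => ?_
  have hpos : (σ.symm ⟨v, by omega⟩ : ℕ) = m ↔ σ ⟨m, hmn⟩ = ⟨v, by omega⟩ := by
    rw [← eq_symm_apply, Fin.ext_iff, eq_comm]
  rw [hstops, and_comm, hpos]
  refine and_congr_right fun hσ => ?_
  have hcount : lowerCount σ k ⟨m, hmn⟩ ≤ v := by simpa [hσ] using lowerCount_le_val σ k ⟨m, hmn⟩
  rw [← hσ, symm_apply_apply]
  exact ⟨fun h => h.2.1, fun h => ⟨hkm, h, Or.inl (hcount.trans_lt hv)⟩⟩

theorem lowerCount_swap_mul {σ : Perm (Fin n)} {M : ℕ} {v w : Fin n} (hvw : (w : ℕ) = v + 1)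
    (hv : M ≤ (σ.symm v : ℕ)) (hw : M ≤ (σ.symm w : ℕ)) (j : Fin n) :
    lowerCount (swap v w * σ) M j = lowerCount σ M j := by
  rw [lowerCount, lowerCount]
  refine congrArg card (filter_congr fun i _ => and_congr_right fun hi => ?_)
  have hiv : σ i ≠ v := fun h => by simp [← h] at hv; omega
  have hiw : σ i ≠ w := fun h => by simp [← h] at hw; omega
  rw [Perm.mul_apply, Perm.mul_apply, swap_apply_of_ne_of_ne hiv hiw, swap_apply_def]
  split_ifs <;> omega

theorem prob_selected_succ_and_le (hl : 1 ≤ l) (hlk : l ≤ k) (hkn : k < n) {v w : Fin n}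
    (hvw : (w : ℕ) = v + 1) :
    prob (fun σ : Perm (Fin n) =>
        selected σ k l = w + 1 ∧ k ≤ (σ.symm v : ℕ) ∧ k ≤ (σ.symm w : ℕ)) =
      prob fun σ : Perm (Fin n) =>
        selected σ k l = v + 1 ∧ k ≤ (σ.symm v : ℕ) ∧ k ≤ (σ.symm w : ℕ) := by
  rw [← prob_comp_equiv (Equiv.mulLeft (swap v w))]
  refine prob_congr fun σ => ?_
  have symm_mul (u : Fin n) : (swap v w * σ).symm u = σ.symm (swap v w u) := rfl
  rw [Equiv.coe_mulLeft, selected_eq_iff hl hlk hkn, selected_eq_iff hl hlk hkn, symm_mul,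
    symm_mul, swap_apply_left, swap_apply_right, and_comm (a := k ≤ _)]
  refine and_congr_left fun ⟨hv, hw⟩ => ?_
  simp only [StopsAt, lowerCount_swap_mul hvw hv hw]

theorem one_le_lowerCount {σ : Perm (Fin n)} {M : ℕ} {i j : Fin n} (hi : (i : ℕ) < M)
    (hij : σ i < σ j) : 1 ≤ lowerCount σ M j :=
  card_pos.2 ⟨i, by simp [hi, hij]⟩

theorem prob_selected_two_and_not_le (hk : 1 ≤ k) (hkn : k < n) {v w : Fin n} (hv : (v : ℕ) = 0)
    (hw : (w : ℕ) = 1) :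
    prob (fun σ : Perm (Fin n) =>
        selected σ k 1 = w + 1 ∧ ¬ (k ≤ (σ.symm v : ℕ) ∧ k ≤ (σ.symm w : ℕ))) =
      k / (n * (n - 1)) := by
  have hvw : v ≠ w := fun h => by omega
  obtain ⟨u, hu⟩ : ∃ u : Fin n, (u : ℕ) = n - 1 := ⟨⟨n - 1, by omega⟩, rfl⟩
  have key := prob_symm_mem_and_symm_mem hvw (A := {i : Fin n | (i : ℕ) < k}) (B := {u})
    (by simp; omega)
  rw [card_filter_val_lt hkn.le, card_singleton, Nat.cast_one, mul_one] at key
  rw [← key]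
  refine prob_congr fun σ => ?_
  rw [selected_eq_iff le_rfl hk hkn, mem_filter_univ, mem_singleton, Fin.ext_iff, hu]
  constructor
  · rintro ⟨⟨hkw, -, hlast⟩, hnot⟩
    have hvk : (σ.symm v : ℕ) < k := by omega
    have := one_le_lowerCount (σ := σ) (j := σ.symm w) hvk (by simp; omega)
    exact ⟨hvk, by omega⟩
  · rintro ⟨hvk, hlast⟩
    refine ⟨⟨by omega, fun i hki _ => one_le_lowerCount hvk ?_, Or.inr hlast⟩, by omega⟩
    have : σ i ≠ v := fun h => by simp [← h] at hvk; omega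
    rw [apply_symm_apply]
    omega

theorem prob_selected_one_and_not_le (hk : 1 ≤ k) (hkn : k < n) {v w : Fin n} (hv : (v : ℕ) = 0)
    (hw : (w : ℕ) = 1) :
    prob (fun σ : Perm (Fin n) =>
        selected σ k 1 = v + 1 ∧ ¬ (k ≤ (σ.symm v : ℕ) ∧ k ≤ (σ.symm w : ℕ))) =
      k * (n - k) / (n * (n - 1)) := by
  have hwv : w ≠ v := fun h => by omega
  have key := prob_symm_mem_and_symm_mem hwv (A := {i : Fin n | (i : ℕ) < k})
    (B := {i : Fin n | ¬ (i : ℕ) < k}) (disjoint_filter_filter_not _ _ _)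
  have hcard : #{i : Fin n | ¬ (i : ℕ) < k} = n - k := by
    rw [filter_not, ← compl_eq_univ_sdiff, card_compl, card_filter_val_lt hkn.le, Fintype.card_fin]
  rw [card_filter_val_lt hkn.le, hcard, Nat.cast_sub hkn.le] at key
  rw [← key]
  refine prob_congr fun σ => ?_
  rw [selected_eq_iff le_rfl hk hkn, mem_filter_univ, mem_filter_univ]
  constructor
  · rintro ⟨⟨hkv, -⟩, hnot⟩
    omega
  · rintro ⟨hwk, hkv⟩
    have hcount := lowerCount_le_val σ k (σ.symm v)
    rw [apply_symm_apply] at hcount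
    refine ⟨⟨by omega, fun i hki hiv => one_le_lowerCount hwk ?_, Or.inl (by omega)⟩, by omega⟩
    have : σ i ≠ v := fun h => by simp [← h] at hiv
    have : σ i ≠ w := fun h => by simp [← h] at hwk; omega
    rw [apply_symm_apply]
    omega

/-- Swapping the two lowest values exchanges the events that they are selected, as long as neither
of them is among the first `k` terms. -/
theorem prob_selected_two (hk : 1 ≤ k) (hkn : k < n) :
    prob (fun σ : Perm (Fin n) => selected σ k 1 = 2) =
      prob (fun σ : Perm (Fin n) => selected σ k 1 = 1) - k * (n - k - 1) / (n * (n - 1)) := by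
  obtain ⟨v, hv⟩ : ∃ v : Fin n, (v : ℕ) = 0 := ⟨⟨0, by omega⟩, rfl⟩
  obtain ⟨w, hw⟩ : ∃ w : Fin n, (w : ℕ) = 1 := ⟨⟨1, by omega⟩, rfl⟩
  have hboth := prob_selected_succ_and_le le_rfl hk hkn (v := v) (w := w) (by omega)
  have htwo := prob_selected_two_and_not_le hk hkn hv hw
  have hone := prob_selected_one_and_not_le hk hkn hv hw
  rw [hv, hw] at hboth
  rw [hw] at htwo
  rw [hv] at hone
  rw [prob_eq_add _ fun σ : Perm (Fin n) => k ≤ (σ.symm v : ℕ) ∧ k ≤ (σ.symm w : ℕ), hboth, htwo,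
    prob_eq_add (fun σ : Perm (Fin n) => selected σ k 1 = 1)
      fun σ : Perm (Fin n) => k ≤ (σ.symm v : ℕ) ∧ k ≤ (σ.symm w : ℕ), hone]
  ring

end SelectionProb

section ClosedForm

variable {n k : ℕ}

theorem expectedReward_one_one (hk : 1 ≤ k) (hkn : k < n) :
    expectedReward n 1 k 1 = k * ∑ m ∈ Ico k n, (m : ℝ)⁻¹ := by
  have hn : (n : ℝ) ≠ 0 := by exact_mod_cast (by omega : n ≠ 0)
  simp only [expectedReward_eq_sum_prob 1 le_rfl hk hkn, sum_range_one,
    prob_selected_eq_of_lt hk hkn one_pos, Nat.choose_one_right, div_eq_mul_inv (k : ℝ), mul_sum]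
  rw [Nat.cast_zero, sub_zero, mul_div_cancel₀ _ hn]

theorem expectedReward_two_one (hk : 1 ≤ k) (hkn : k < n) :
    expectedReward n 2 k 1 =
      (2 * n - 1) / n * (k * ∑ m ∈ Ico k n, (m : ℝ)⁻¹) - k * (n - k - 1) / n := by
  have hn : (1 : ℝ) < n := by exact_mod_cast (by omega : 1 < n)
  have hn1 : (n : ℝ) - 1 ≠ 0 := by linarith
  have hone : prob (fun σ : Perm (Fin n) => selected σ k 1 = 1) =
      (k * ∑ m ∈ Ico k n, (m : ℝ)⁻¹) / n := by
    simp only [prob_selected_eq_of_lt hk hkn one_pos, Nat.choose_one_right,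
      div_eq_mul_inv (k : ℝ), mul_sum]
  rw [expectedReward_eq_sum_prob 2 le_rfl hk hkn, sum_range_succ, sum_range_one, zero_add,
    one_add_one_eq_two, prob_selected_two hk hkn, hone, Nat.cast_zero, Nat.cast_one]
  field_simp
  ring

theorem sum_choose_two_div_choose_two (hk : 2 ≤ k) (hkn : k ≤ n) :
    ∑ m ∈ Ico k n, (k.choose 2 : ℝ) / m.choose 2 = k * (n - k) / (n - 1) := by
  induction n, hkn using Nat.le_induction with
  | base => simp
  | succ n hkn ih =>
    have hn : (2 : ℝ) ≤ n := by exact_mod_cast hk.trans hkn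
    have hn1 : (n : ℝ) - 1 ≠ 0 := by linarith
    rw [sum_Ico_succ_top hkn, ih, Nat.cast_choose_two, Nat.cast_choose_two, Nat.cast_add_one,
      add_sub_cancel_right]
    field_simp
    ring

theorem expectedReward_two_two (hk : 2 ≤ k) (hkn : k < n) :
    expectedReward n 2 k 2 = (2 * n - 1) / n * (k * (n - k) / (n - 1)) := by
  rw [expectedReward_eq_sum_prob 2 one_le_two hk hkn, sum_range_succ, sum_range_one,
    prob_selected_eq_of_lt hk hkn two_pos, prob_selected_eq_of_lt hk hkn one_lt_two,
    sum_choose_two_div_choose_two hk hkn.le, Nat.cast_zero, Nat.cast_one]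
  ring

end ClosedForm

section Asymptotics

variable {n k : ℕ}

theorem log_div_le_sum_Ico_inv (hk : 1 ≤ k) (hkn : k ≤ n) :
    Real.log (n / k) ≤ ∑ m ∈ Ico k n, (m : ℝ)⁻¹ := by
  have hk0 : (0 : ℝ) < k := by exact_mod_cast hk
  have hn0 : (0 : ℝ) < n := by exact_mod_cast hk.trans hkn
  rw [← integral_inv_of_pos hk0 hn0]
  exact AntitoneOn.integral_le_sum_Ico hkn
    (inv_antitoneOn_Icc_right hk0)

theorem sum_Ico_inv_le_log_div (hk : 1 ≤ k) (hkn : k ≤ n) :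
    ∑ m ∈ Ico k n, (m : ℝ)⁻¹ ≤ Real.log (n / k) + (k : ℝ)⁻¹ := by
  have hk0 : (0 : ℝ) < k := by exact_mod_cast hk
  have hn0 : (0 : ℝ) < n := by exact_mod_cast hk.trans hkn
  have hint : ∑ m ∈ Ico k n, ((m + 1 : ℕ) : ℝ)⁻¹ ≤ Real.log (n / k) := by
    rw [← integral_inv_of_pos hk0 hn0]
    exact AntitoneOn.sum_le_integral_Ico hkn (inv_antitoneOn_Icc_right hk0)
  have hshift := sum_Ico_sub (fun m : ℕ => (m : ℝ)⁻¹) hkn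
  rw [sum_sub_distrib] at hshift
  have := inv_pos.2 hn0
  linarith

theorem mul_sum_Ico_inv_div_le (hk : 1 ≤ k) (hkn : k ≤ n) :
    k * (∑ m ∈ Ico k n, (m : ℝ)⁻¹) / n ≤ 1 := by
  have hk0 : (0 : ℝ) < k := by exact_mod_cast hk
  have hn0 : (0 : ℝ) < n := by exact_mod_cast hk.trans hkn
  rw [div_le_one hn0]
  calc k * (∑ m ∈ Ico k n, (m : ℝ)⁻¹) ≤ k * ∑ _ ∈ Ico k n, (k : ℝ)⁻¹ := by
        gcongr with m hm
        exact (mem_Ico.1 hm).1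
    _ = n - k := by
        rw [sum_const, Nat.card_Ico, nsmul_eq_mul, Nat.cast_sub hkn]
        field_simp
    _ ≤ n := by linarith

theorem mul_sum_Ico_inv_div_mem_Icc (hk : 1 ≤ k) (hkn : k ≤ n) :
    k * (∑ m ∈ Ico k n, (m : ℝ)⁻¹) / n ∈
      Set.Icc (Real.negMulLog (k / n)) (Real.negMulLog (k / n) + 1 / n) := by
  have hk0 : (0 : ℝ) < k := by exact_mod_cast hk
  have hn0 : (0 : ℝ) < n := by exact_mod_cast hk.trans hkn
  have hlog : Real.negMulLog (k / n) = k * Real.log (n / k) / n := by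
    rw [Real.negMulLog, ← inv_div, Real.log_inv]
    field_simp
  have hadd : k * Real.log (n / k) / n + 1 / n = k * (Real.log (n / k) + (k : ℝ)⁻¹) / n := by
    rw [← add_div, mul_add, mul_inv_cancel₀ hk0.ne']
  rw [hlog, hadd]
  exact ⟨by gcongr; exact log_div_le_sum_Ico_inv hk hkn,
    by gcongr; exact sum_Ico_inv_le_log_div hk hkn⟩

/-- The limit of `V_{n,2}(k,1) / n` when `n → ∞` and `k / n → t`. -/
noncomputable def limitProfile (t : ℝ) : ℝ :=
  2 * Real.negMulLog t - t * (1 - t)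

theorem abs_expectedReward_one_one_div_sub_le (hk : 1 ≤ k) (hkn : k < n) :
    |expectedReward n 1 k 1 / n - Real.negMulLog (k / n)| ≤ 1 / n := by
  obtain ⟨hlow, hupp⟩ := mul_sum_Ico_inv_div_mem_Icc hk hkn.le
  rw [expectedReward_one_one hk hkn, abs_of_nonneg (sub_nonneg.2 hlow)]
  linarith

theorem abs_expectedReward_two_one_div_sub_le (hk : 1 ≤ k) (hkn : k < n) :
    |expectedReward n 2 k 1 / n - limitProfile (k / n)| ≤ 3 / n := by
  have hn0 : (0 : ℝ) < n := by exact_mod_cast (by omega : 0 < n)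
  obtain ⟨hlow, hupp⟩ := mul_sum_Ico_inv_div_mem_Icc hk hkn.le
  have hu1 := mul_sum_Ico_inv_div_le hk hkn.le
  have hV := expectedReward_two_one hk hkn
  set u := k * (∑ m ∈ Ico k n, (m : ℝ)⁻¹) / n with hu
  set t := (k : ℝ) / n with ht
  have hu0 : 0 ≤ u := by positivity
  have ht0 : 0 ≤ t := by positivity
  have ht1 : t ≤ 1 := (div_le_one hn0).2 (by exact_mod_cast hkn.le)
  have hdiff : expectedReward n 2 k 1 / n - limitProfile t =
      2 * (u - Real.negMulLog t) + (t - u) * (1 / n) := by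
    rw [hV, limitProfile, hu, ht]
    field_simp
    ring
  have htu : |t - u| ≤ 1 := abs_le.2 ⟨by linarith, by linarith⟩
  calc |expectedReward n 2 k 1 / n - limitProfile t|
      ≤ |2 * (u - Real.negMulLog t)| + |(t - u) * (1 / n)| := hdiff ▸ abs_add_le _ _
    _ = 2 * (u - Real.negMulLog t) + |t - u| * (1 / n) := by
        rw [abs_of_nonneg (by linarith), abs_mul, abs_of_pos (one_div_pos.2 hn0)]
    _ ≤ 2 * (1 / n) + 1 * (1 / n) := by
        gcongr
        linarith
    _ = 3 / n := by ring

theorem abs_expectedReward_two_two_div_sub_le (hk : 2 ≤ k) (hkn : k < n) :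
    |expectedReward n 2 k 2 / n - 2 * (k / n * (1 - k / n))| ≤ 1 / n := by
  have hk0 : (2 : ℝ) ≤ k := by exact_mod_cast hk
  have hkn' : (k : ℝ) < n := by exact_mod_cast hkn
  have hn0 : (0 : ℝ) < n := by linarith
  have hn1 : (0 : ℝ) < n - 1 := by linarith
  have hdiff : expectedReward n 2 k 2 / n - 2 * (k / n * (1 - k / n)) =
      k / n * ((n - k) / (n - 1)) * (1 / n) := by
    rw [expectedReward_two_two hk hkn]
    field_simp
    ring
  have hfst : (k : ℝ) / n ≤ 1 := (div_le_one hn0).2 hkn'.le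
  have hsnd : ((n : ℝ) - k) / (n - 1) ≤ 1 := (div_le_one hn1).2 (by linarith)
  have hsnd0 : 0 ≤ ((n : ℝ) - k) / (n - 1) := div_nonneg (by linarith) hn1.le
  rw [hdiff, abs_of_nonneg (mul_nonneg (mul_nonneg (by positivity) hsnd0) (by positivity))]
  calc (k : ℝ) / n * ((n - k) / (n - 1)) * (1 / n) ≤ 1 * 1 * (1 / n) := by gcongr
    _ = 1 / n := by ring

end Asymptotics

section LimitOfMaxima

theorem tendsto_of_isGreatest_image {v : ℕ → ℕ → ℝ} {f : ℝ → ℝ} {M ε : ℕ → ℝ} {x : ℝ} {l : ℕ}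
    (hl : 1 ≤ l) (hx : x ∈ Set.Ioo 0 1) (hf : ContinuousAt f x)
    (hmax : IsMaxOn f (Set.Ioo 0 1) x)
    (hv : ∀ n, ∀ k ∈ Set.Ico l n, |v n k - f (k / n)| ≤ ε n) (hε : Tendsto ε atTop (𝓝 0))
    (hM : ∀ᶠ n in atTop, IsGreatest (v n '' Set.Ico l n) (M n)) :
    Tendsto M atTop (𝓝 (f x)) := by
  have hfloor : Tendsto (fun n : ℕ => (⌊x * n⌋₊ : ℝ) / n) atTop (𝓝 x) :=
    (tendsto_nat_floor_mul_div_atTop hx.1.le).comp tendsto_natCast_atTop_atTop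
  have hlow : Tendsto (fun n : ℕ => f (⌊x * n⌋₊ / n) - ε n) atTop (𝓝 (f x)) := by
    simpa only [sub_zero, Function.comp_apply] using (hf.tendsto.comp hfloor).sub hε
  have hupp : Tendsto (fun n => f x + ε n) atTop (𝓝 (f x)) := by
    simpa only [add_zero] using hε.const_add (f x)
  have hlarge : ∀ᶠ n : ℕ in atTop, l ≤ ⌊x * n⌋₊ :=
    (tendsto_nat_floor_atTop.comp
      (tendsto_natCast_atTop_atTop.const_mul_atTop hx.1)).eventually_ge_atTop l
  refine tendsto_of_tendsto_of_tendsto_of_le_of_le' hlow hupp ?_ ?_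
  · filter_upwards [hlarge, eventually_gt_atTop 0, hM] with n hln hn hMn
    have hlt : ⌊x * n⌋₊ < n :=
      (Nat.floor_lt' hn.ne').2 (mul_lt_of_lt_one_left (by exact_mod_cast hn) hx.2)
    have hclose := (abs_le.1 (hv n _ ⟨hln, hlt⟩)).1
    have hle := hMn.2 ⟨_, ⟨hln, hlt⟩, rfl⟩
    linarith
  · filter_upwards [hM] with n hMn
    obtain ⟨k, hk, hkM⟩ := hMn.1
    have hk0 : (0 : ℝ) < k := by exact_mod_cast hl.trans hk.1
    have hkn : (k : ℝ) < n := by exact_mod_cast hk.2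
    have hclose := (abs_le.1 (hv n k hk)).2
    have hle : f (k / n) ≤ f x :=
      hmax ⟨div_pos hk0 (hk0.trans hkn), (div_lt_one (hk0.trans hkn)).2 hkn⟩
    linarith

theorem isGreatest_image_maxRewardAt_div {n l : ℕ} (hl : 1 ≤ l) (hn : l < n) (d : ℕ) :
    IsGreatest ((fun k => expectedReward n d k l / n) '' Set.Ico l n)
      (maxRewardAt n d l / n) := by
  have hset : rewardSetAt n d l = (fun k => expectedReward n d k l) '' Set.Ico l n := by
    ext v
    exact ⟨fun ⟨k, _, hlk, hkn, hv⟩ => ⟨k, ⟨hlk, hkn⟩, hv.symm⟩,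
      fun ⟨k, hk, hv⟩ => ⟨k, hl, hk.1, hk.2, hv.symm⟩⟩
  have hmono : Monotone fun v : ℝ => v / n := fun _ _ h => by dsimp only; gcongr
  have hgreatest := hmono.map_isGreatest (maxRewardAt_isGreatest hl hn d)
  rwa [hset, Set.image_image] at hgreatest

theorem tendsto_maxRewardAt_div {d l : ℕ} {f : ℝ → ℝ} {x C : ℝ} (hl : 1 ≤ l)
    (hx : x ∈ Set.Ioo 0 1) (hf : ContinuousAt f x) (hmax : IsMaxOn f (Set.Ioo 0 1) x)
    (happrox : ∀ n k : ℕ, l ≤ k → k < n → |expectedReward n d k l / n - f (k / n)| ≤ C / n) :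
    Tendsto (fun n : ℕ => maxRewardAt n d l / (n : ℝ)) atTop (𝓝 (f x)) := by
  refine tendsto_of_isGreatest_image hl hx hf hmax (fun n k hk => happrox n k hk.1 hk.2)
    (tendsto_const_div_atTop_nhds_zero_nat C) ?_
  filter_upwards [eventually_gt_atTop l] with n hn
  exact isGreatest_image_maxRewardAt_div hl hn d

end LimitOfMaxima

section Calculus

theorem negMulLog_exp_neg_one : Real.negMulLog (Real.exp (-1)) = Real.exp (-1) := by
  rw [Real.negMulLog, Real.log_exp]
  ring

theorem isMaxOn_negMulLog : IsMaxOn Real.negMulLog (Set.Ioo 0 1) (Real.exp (-1)) := by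
  intro t ht
  have hexp : Real.exp (-Real.log t - 1) = Real.exp (-1) / t := by
    rw [sub_eq_neg_add, Real.exp_add, Real.exp_neg (Real.log t), Real.exp_log ht.1, div_eq_mul_inv]
  have htangent := Real.add_one_le_exp (-Real.log t - 1)
  rw [hexp, sub_add_cancel, le_div_iff₀ ht.1] at htangent
  rw [Set.mem_ofPred_eq, negMulLog_exp_neg_one, Real.negMulLog]
  linarith

theorem hasDerivAt_two_mul_sub_log {z : ℝ} (hz : z ≠ 0) :
    HasDerivAt (fun z => 2 * z - 2 * Real.log z) (2 - 2 * z⁻¹) z := by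
  simpa only [mul_one] using
    ((hasDerivAt_id' z).const_mul 2).fun_sub ((Real.hasDerivAt_log hz).const_mul 2)

theorem continuousOn_two_mul_sub_log :
    ContinuousOn (fun z => 2 * z - 2 * Real.log z) (Set.Ioi 0) := fun _ hz =>
  (hasDerivAt_two_mul_sub_log (Set.mem_Ioi.1 hz).ne').continuousAt.continuousWithinAt

theorem strictAntiOn_two_mul_sub_log :
    StrictAntiOn (fun z => 2 * z - 2 * Real.log z) (Set.Ioc 0 1) := by
  refine strictAntiOn_of_deriv_neg (convex_Ioc 0 1)
    (continuousOn_two_mul_sub_log.mono fun _ hz => hz.1) fun z hz => ?_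
  rw [interior_Ioc] at hz
  rw [(hasDerivAt_two_mul_sub_log hz.1.ne').deriv]
  linarith [(one_lt_inv₀ hz.1).2 hz.2]

theorem strictMonoOn_two_mul_sub_log :
    StrictMonoOn (fun z => 2 * z - 2 * Real.log z) (Set.Ici 1) := by
  refine strictMonoOn_of_deriv_pos (convex_Ici 1)
    (continuousOn_two_mul_sub_log.mono (Set.Ici_subset_Ioi.2 one_pos)) fun z hz => ?_
  rw [interior_Ici] at hz
  rw [(hasDerivAt_two_mul_sub_log (one_pos.trans hz).ne').deriv]
  linarith [inv_lt_one_of_one_lt₀ (Set.mem_Ioi.1 hz)]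

theorem setOf_two_mul_sub_log_eq {c x y : ℝ} (hx : x ∈ Set.Ioc 0 1) (hy : 1 ≤ y)
    (hxc : 2 * x - 2 * Real.log x = c) (hyc : 2 * y - 2 * Real.log y = c) :
    {z : ℝ | 0 < z ∧ 2 * z - 2 * Real.log z = c} = {x, y} := by
  refine Set.Subset.antisymm ?_ ?_
  · rintro z ⟨hz0, hz⟩
    rcases le_total z 1 with hz1 | hz1
    · exact Or.inl (strictAntiOn_two_mul_sub_log.injOn ⟨hz0, hz1⟩ hx (hz.trans hxc.symm))
    · exact Or.inr (strictMonoOn_two_mul_sub_log.injOn hz1 hy (hz.trans hyc.symm))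
  · rintro z (rfl | rfl)
    · exact ⟨hx.1, hxc⟩
    · exact ⟨one_pos.trans_le hy, hyc⟩

theorem log_three_div_ten : Real.log (3 / 10) = Real.log 3 - (Real.log 2 + Real.log 5) := by
  rw [Real.log_div (by norm_num) (by norm_num), ← Real.log_mul (by norm_num) (by norm_num)]
  norm_num

theorem log_0301706_lt : Real.log 0.301706 < -1.198294 := by
  -- `(1 + w) / (1 - w) = 0.301706 / 0.3` for `w = (0.301706 - 0.3) / (0.301706 + 0.3)`
  have hseries := Real.log_div_le_sum_range_add (x := 853 / 300853) (by norm_num) (by norm_num) 1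
  have hfactor : Real.log 0.301706 = Real.log (3 / 10) +
      Real.log ((1 + 853 / 300853) / (1 - 853 / 300853)) := by
    rw [← Real.log_mul (by norm_num) (by norm_num)]
    norm_num
  rw [log_three_div_ten] at hfactor
  norm_num at hseries hfactor ⊢
  linarith [Real.log_two_gt_d9, Real.log_three_lt_d9, Real.log_five_gt_d9]

theorem lt_log_0301712 : -1.198288 < Real.log 0.301712 := by
  have hseries := Real.sum_range_le_log_div (x := 107 / 37607) (by norm_num) (by norm_num) 1
  have hfactor : Real.log 0.301712 = Real.log (3 / 10) +
      Real.log ((1 + 107 / 37607) / (1 - 107 / 37607)) := by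
    rw [← Real.log_mul (by norm_num) (by norm_num)]
    norm_num
  rw [log_three_div_ten] at hfactor
  norm_num at hseries hfactor ⊢
  linarith [Real.log_two_lt_d9, Real.log_three_gt_d9, Real.log_five_lt_d9]

theorem exists_small_root :
    ∃ x ∈ Set.Ioo 0.301706 0.301712, 2 * x - 2 * Real.log x = 3 :=
  intermediate_value_Ioo' (by norm_num)
    (continuousOn_two_mul_sub_log.mono fun _ hz => lt_of_lt_of_le (by norm_num) hz.1)
    ⟨by linarith [lt_log_0301712], by linarith [log_0301706_lt]⟩

theorem exists_large_root : ∃ y ∈ Set.Ioo 1 4, 2 * y - 2 * Real.log y = 3 := by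
  have hlog : Real.log 4 = 2 * Real.log 2 := by
    rw [← Real.log_rpow two_pos]
    norm_num
  refine intermediate_value_Ioo (by norm_num)
    (continuousOn_two_mul_sub_log.mono fun _ hz => zero_lt_one.trans_le hz.1) ⟨?_, ?_⟩
  · norm_num
  · linarith [Real.log_two_lt_d9]

theorem continuous_limitProfile : Continuous limitProfile := by
  have := Real.continuous_negMulLog
  unfold limitProfile
  fun_prop

theorem hasDerivAt_limitProfile {t : ℝ} (ht : t ≠ 0) :
    HasDerivAt limitProfile (2 * t - 2 * Real.log t - 3) t := by
  have hpoly := (hasDerivAt_id' t).fun_mul ((hasDerivAt_id' t).const_sub 1)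
  refine (((Real.hasDerivAt_negMulLog ht).const_mul 2).fun_sub hpoly).congr_deriv ?_
  ring

theorem limitProfile_eq {x : ℝ} (hx : 2 * x - 2 * Real.log x = 3) :
    limitProfile x = 2 * x - x ^ 2 := by
  rw [limitProfile, Real.negMulLog]
  linear_combination x * hx

theorem isMaxOn_limitProfile {x : ℝ} (hx01 : x ∈ Set.Ioo 0 1)
    (hx : 2 * x - 2 * Real.log x = 3) : IsMaxOn limitProfile (Set.Ioo 0 1) x := by
  have hdiff : ∀ t, 0 < t → HasDerivAt limitProfile (2 * t - 2 * Real.log t - 3) t :=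
    fun t ht => hasDerivAt_limitProfile ht.ne'
  refine isMaxOn_Ioo_of_deriv continuous_limitProfile.continuousAt
    (fun t ht => (hdiff t ht.1).differentiableAt.differentiableWithinAt)
    (fun t ht => (hdiff t (hx01.1.trans ht.1)).differentiableAt.differentiableWithinAt)
    (fun t ht => ?_) fun t ht => ?_
  · have hanti := strictAntiOn_two_mul_sub_log ⟨ht.1, (ht.2.trans hx01.2).le⟩
      ⟨hx01.1, hx01.2.le⟩ ht.2
    rw [(hdiff t ht.1).deriv]
    linarith
  · have ht0 := hx01.1.trans ht.1
    have hanti := strictAntiOn_two_mul_sub_log ⟨hx01.1, hx01.2.le⟩ ⟨ht0, ht.2.le⟩ ht.1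
    rw [(hdiff t ht0).deriv]
    linarith

theorem isMaxOn_two_mul_mul_one_sub (s : Set ℝ) :
    IsMaxOn (fun t : ℝ => 2 * (t * (1 - t))) s (1 / 2) := fun t _ => by
  change 2 * (t * (1 - t)) ≤ 2 * (1 / 2 * (1 - 1 / 2))
  linarith [sq_nonneg (2 * t - 1)]

end Calculus

section Maxima

theorem tendsto_maxRewardAt_one_one :
    Tendsto (fun n : ℕ => maxRewardAt n 1 1 / (n : ℝ)) atTop (𝓝 (Real.exp (-1))) := by
  have h := tendsto_maxRewardAt_div le_rfl
    ⟨Real.exp_pos _, Real.exp_lt_one_iff.2 neg_one_lt_zero⟩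
    Real.continuous_negMulLog.continuousAt isMaxOn_negMulLog
    fun n k hk hkn => abs_expectedReward_one_one_div_sub_le hk hkn
  rwa [negMulLog_exp_neg_one] at h

theorem tendsto_maxRewardAt_two_one {x : ℝ} (hx01 : x ∈ Set.Ioo 0 1)
    (hx : 2 * x - 2 * Real.log x = 3) :
    Tendsto (fun n : ℕ => maxRewardAt n 2 1 / (n : ℝ)) atTop (𝓝 (2 * x - x ^ 2)) := by
  rw [← limitProfile_eq hx]
  exact tendsto_maxRewardAt_div le_rfl hx01 continuous_limitProfile.continuousAt
    (isMaxOn_limitProfile hx01 hx)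
    fun n k hk hkn => abs_expectedReward_two_one_div_sub_le hk hkn

theorem tendsto_maxRewardAt_two_two :
    Tendsto (fun n : ℕ => maxRewardAt n 2 2 / (n : ℝ)) atTop (𝓝 (1 / 2)) := by
  have h := tendsto_maxRewardAt_div one_le_two (by norm_num) (by fun_prop)
    (isMaxOn_two_mul_mul_one_sub _)
    fun n k hk hkn => abs_expectedReward_two_two_div_sub_le hk hkn
  convert h using 2
  norm_num

theorem eventually_maxRewardAt_two_two_lt {x : ℝ} (hx01 : x ∈ Set.Ioo 0 1)
    (hx : 2 * x - 2 * Real.log x = 3) (hhalf : 1 / 2 < 2 * x - x ^ 2) :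
    ∀ᶠ n : ℕ in atTop, maxRewardAt n 2 2 < maxRewardAt n 2 1 := by
  filter_upwards [tendsto_maxRewardAt_two_two.eventually_lt
    (tendsto_maxRewardAt_two_one hx01 hx) hhalf, eventually_gt_atTop 0] with n hn hn0
  exact (div_lt_div_iff_of_pos_right (by exact_mod_cast hn0)).1 hn

theorem rewardSetAt_subset_rewardSet (n d l : ℕ) : rewardSetAt n d l ⊆ rewardSet n d :=
  fun _ ⟨k, hl, hlk, hkn, hv⟩ => ⟨k, l, hl, hlk, hkn, hv⟩

theorem maxReward_one_eq {n : ℕ} (hn : 2 ≤ n) : maxReward n 1 = maxRewardAt n 1 1 := by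
  have hone := maxRewardAt_isGreatest le_rfl hn 1
  refine (maxReward_isGreatest hn 1).unique ⟨rewardSetAt_subset_rewardSet n 1 1 hone.1, ?_⟩
  rintro _ ⟨k, l, hl, hlk, hkn, rfl⟩
  exact (expectedReward_le_of_le le_rfl le_rfl hl hlk hkn).trans
    (hone.2 ⟨k, le_rfl, hl.trans hlk, hkn, rfl⟩)

theorem maxReward_two_eq {n : ℕ} (hn : 3 ≤ n) (h : maxRewardAt n 2 2 ≤ maxRewardAt n 2 1) :
    maxReward n 2 = maxRewardAt n 2 1 := by
  have hone := maxRewardAt_isGreatest le_rfl (by omega : 1 < n) 2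
  have htwo := maxRewardAt_isGreatest one_le_two hn 2
  refine (maxReward_isGreatest (by omega) 2).unique
    ⟨rewardSetAt_subset_rewardSet n 2 1 hone.1, ?_⟩
  rintro _ ⟨k, l, hl, hlk, hkn, rfl⟩
  rcases hl.eq_or_lt with rfl | hl2
  · exact hone.2 ⟨k, le_rfl, hlk, hkn, rfl⟩
  · calc expectedReward n 2 k l ≤ expectedReward n 2 k 2 :=
          expectedReward_le_of_le one_le_two le_rfl hl2 hlk hkn
      _ ≤ maxRewardAt n 2 2 := htwo.2 ⟨k, one_le_two, le_trans hl2 hlk, hkn, rfl⟩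
      _ ≤ maxRewardAt n 2 1 := h

theorem tendsto_maxReward_one :
    Tendsto (fun n : ℕ => maxReward n 1 / (n : ℝ)) atTop (𝓝 (Real.exp (-1))) := by
  refine tendsto_maxRewardAt_one_one.congr' ?_
  filter_upwards [eventually_ge_atTop 2] with n hn
  rw [maxReward_one_eq hn]

theorem tendsto_maxReward_two {x : ℝ} (hx01 : x ∈ Set.Ioo 0 1)
    (hx : 2 * x - 2 * Real.log x = 3) (hhalf : 1 / 2 < 2 * x - x ^ 2) :
    Tendsto (fun n : ℕ => maxReward n 2 / (n : ℝ)) atTop (𝓝 (2 * x - x ^ 2)) := by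
  refine (tendsto_maxRewardAt_two_one hx01 hx).congr' ?_
  filter_upwards [eventually_maxRewardAt_two_two_lt hx01 hx hhalf, eventually_ge_atTop 3]
    with n hlt hn
  rw [maxReward_two_eq hn hlt.le]

end Maxima

end Secretary

theorem theorem3 :
    -- d = 1
    (Tendsto (fun n : ℕ => Secretary.maxReward n 1 / (n : ℝ)) atTop (𝓝 (1 / Real.exp 1)) ∧
      |1 / Real.exp 1 - 0.36788| < 0.000005 ∧
      -- for fixed n and k, the choice l = 1 is optimal
      ∀ n k l : ℕ, 1 ≤ l → l ≤ k → k < n →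
        Secretary.expectedReward n 1 k l ≤ Secretary.expectedReward n 1 k 1) ∧
    -- d = 2
    ∃ x y : ℝ,
      -- the equation has exactly two roots, and x is the smaller one
      x < y ∧ {z : ℝ | 0 < z ∧ 2 * z - 2 * Real.log z = 3} = {x, y} ∧
      |x - 0.30171| < 0.000005 ∧
      Tendsto (fun n : ℕ => Secretary.maxReward n 2 / (n : ℝ)) atTop (𝓝 (2 * x - x ^ 2)) ∧
      |(2 * x - x ^ 2) - 0.51239| < 0.000005 ∧
      -- for fixed n and k, the expected reward is decreasing in l for l ≥ 2
      (∀ n k l l' : ℕ, 2 ≤ l → l ≤ l' → l' ≤ k → k < n →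
        Secretary.expectedReward n 2 k l' ≤ Secretary.expectedReward n 2 k l) ∧
      -- the maxima for l = 1 and for l = 2
      Tendsto (fun n : ℕ => Secretary.maxRewardAt n 2 1 / (n : ℝ)) atTop (𝓝 (2 * x - x ^ 2)) ∧
      Tendsto (fun n : ℕ => Secretary.maxRewardAt n 2 2 / (n : ℝ)) atTop (𝓝 (1 / 2)) ∧
      ∀ᶠ n : ℕ in atTop, Secretary.maxRewardAt n 2 2 < Secretary.maxRewardAt n 2 1 := by
  obtain ⟨x, ⟨hxlow, hxupp⟩, hx⟩ := Secretary.exists_small_root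
  obtain ⟨y, hymem, hy⟩ := Secretary.exists_large_root
  have hx01 : x ∈ Set.Ioo 0 1 := ⟨by linarith, by linarith⟩
  have hc₂ : |(2 * x - x ^ 2) - 0.51239| < 0.000005 :=
    abs_lt.2 ⟨by nlinarith, by nlinarith⟩
  have hhalf : 1 / 2 < 2 * x - x ^ 2 := by linarith [(abs_lt.1 hc₂).1]
  rw [one_div, ← Real.exp_neg]
  refine ⟨⟨Secretary.tendsto_maxReward_one, ?_,
      fun n k l => Secretary.expectedReward_le_of_le le_rfl le_rfl⟩,
    x, y, by linarith [hymem.1], Secretary.setOf_two_mul_sub_log_eq ⟨hx01.1, hx01.2.le⟩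
      hymem.1.le hx hy, abs_lt.2 ⟨by linarith, by linarith⟩,
    Secretary.tendsto_maxReward_two hx01 hx hhalf, hc₂,
    fun n k l l' hl => Secretary.expectedReward_le_of_le (one_le_two.trans hl) hl,
    Secretary.tendsto_maxRewardAt_two_one hx01 hx, Secretary.tendsto_maxRewardAt_two_two,
    Secretary.eventually_maxRewardAt_two_two_lt hx01 hx hhalf⟩
  exact abs_lt.2 ⟨by linarith [Real.exp_neg_one_gt_d9], by linarith [Real.exp_neg_one_lt_d9]⟩
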